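/- Work with the complex affine plane $\mathbb{A}^2_{\mathbf C}$ with coordinates $(x,y)$. A \emph{polynomial automorphism} of $\mathbb{A}^2_{\mathbf C}$ is a polynomial map $\mathbb{A}^2_{\mathbf C}\to\mathbb{A}^2_{\mathbf C}$ that has a polynomial inverse; these form the group $\mathsf{Aut}(\mathbb{A}^2_{\mathbf C})$. A \emph{generalized Hénon map} is a composition of one or more maps of the form $(x,y)\mapsto (ay+p(x),x)$ with $a\in\mathbf C\setminus\{0\}$ and $p\in\mathbf C[x]$ of degree $\geq 2$. A \emph{Hénon automorphism} is an element of $\mathsf{Aut}(\mathbb{A}^2_{\mathbf C})$ that is conjugate, in $\mathsf{Aut}(\mathbb{A}^2_{\mathbf C})$, to a generalized Hénon map. A \emph{birational transformation} of $\mathbb{A}^2_{\mathbf C}$ is a dominant rational map $\mathbb{A}^2_{\mathbf C}\dashrightarrow\mathbb{A}^2_{\mathbf C}$ that has an inverse rational map. \textbf{Lemma.} Let $f$ and $g\in\mathsf{Aut}(\mathbb{A}^2_{\mathbf C})$ be two Hénon automorphisms. If $\psi$ is a birational transformation of the affine plane that conjugates $f$ to $g$, i.e. $\psi\circ f=g\circ\psi$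 as rational maps, then $\psi$ is a polynomial automorphism of $\mathbb{A}^2_{\mathbf C}$. -/

import Mathlib

namespace AffinePlane

/-- The ring `ℂ[x, y]` of regular functions on the affine plane (`x = X 0`, `y = X 1`). -/
abbrev Poly : Type := MvPolynomial (Fin 2) ℂ

/-- The field `ℂ(x, y)` of rational functions on the affine plane. -/
abbrev RatFun : Type := FractionRing Poly

/-! ### Polynomial maps and polynomial automorphisms -/

/-- A polynomial self-map `(f₀, f₁)` of the affine plane, given by its two coordinates. -/
abbrev PolyMap : Type := Fin 2 → Poly

/-- The identity `(x, y)`. -/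
noncomputable def PolyMap.id : PolyMap := fun i => MvPolynomial.X i

/-- The composition `f ∘ g`: substitute `g₀, g₁` for the variables in the coordinates of `f`. -/
noncomputable def PolyMap.comp (f g : PolyMap) : PolyMap :=
  fun i => MvPolynomial.bind₁ g (f i)

/-- A polynomial automorphism of the affine plane: a polynomial map with a polynomial inverse. -/
@[ext] structure PolyAut : Type where
  toMap : PolyMap
  invMap : PolyMap
  comp_inv : toMap.comp invMap = PolyMap.id
  inv_comp : invMap.comp toMap = PolyMap.id

/-! ### Hénon automorphisms -/

/-- The polynomial map `(x, y) ↦ (a y + p(x), x)`. -/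
noncomputable def henonMap (a : ℂ) (p : Polynomial ℂ) : PolyMap :=
  ![MvPolynomial.C a * MvPolynomial.X 1 + Polynomial.aeval (MvPolynomial.X 0 : Poly) p,
    MvPolynomial.X 0]

/-- Generalized Hénon maps: compositions of one or more maps `(x, y) ↦ (a y + p(x), x)`
with `a ≠ 0` and `deg p ≥ 2`. -/
inductive IsGeneralizedHenon : PolyMap → Prop
  | single (a : ℂ) (p : Polynomial ℂ) (ha : a ≠ 0) (hp : 2 ≤ p.natDegree) :
      IsGeneralizedHenon (henonMap a p)
  | comp (f g : PolyMap) (hf : IsGeneralizedHenon f) (hg : IsGeneralizedHenon g) :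
      IsGeneralizedHenon (f.comp g)

/-- A Hénon automorphism: a polynomial automorphism that is conjugate, in the group of polynomial
automorphisms of the affine plane, to a generalized Hénon map. -/
def PolyAut.IsHenon (f : PolyAut) : Prop :=
  ∃ h : PolyAut, IsGeneralizedHenon ((h.toMap.comp f.toMap).comp h.invMap)

/-! ### Rational and birational maps -/

/-- A dominant rational self-map `(ψ₀, ψ₁)` of the affine plane, given by its two coordinates.
Dominance means that no nonzero polynomial vanishes identically on the image, that is, that the
two coordinates are algebraically independent over `ℂ`. -/
@[ext] structure RatMap : Type where
  coord : Fin 2 → RatFun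
  dominant : AlgebraicIndependent ℂ coord

namespace RatMap

/-- Substitution of the coordinates of `ψ` for the variables in a rational function:
`P / Q ↦ P(ψ₀, ψ₁) / Q(ψ₀, ψ₁)`, where `Q(ψ₀, ψ₁) ≠ 0` because `ψ` is dominant. -/
noncomputable def pullback (ψ : RatMap) : RatFun →ₐ[ℂ] RatFun :=
  IsFractionRing.liftAlgHom (g := MvPolynomial.aeval ψ.coord) ψ.dominant

theorem pullback_algebraMap (ψ : RatMap) (P : Poly) :
    ψ.pullback (algebraMap Poly RatFun P) = MvPolynomial.aeval ψ.coord P :=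
  IsFractionRing.lift_algebraMap ψ.dominant P

/-- The identity `(x, y)`. -/
noncomputable def id : RatMap where
  coord i := algebraMap Poly RatFun (MvPolynomial.X i)
  dominant := (MvPolynomial.algebraicIndependent_X (Fin 2) ℂ).map'
    (f := IsScalarTower.toAlgHom ℂ Poly RatFun) (IsFractionRing.injective Poly RatFun)

/-- The composition `ψ ∘ φ` of dominant rational maps. -/
noncomputable def comp (ψ φ : RatMap) : RatMap where
  coord i := φ.pullback (ψ.coord i)
  dominant := ψ.dominant.map' (f := φ.pullback) φ.pullback.toRingHom.injective

/-- A birational transformation: a (dominant) rational map that has an inverse rational map. -/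
def IsBirational (ψ : RatMap) : Prop :=
  ∃ φ : RatMap, ψ.comp φ = RatMap.id ∧ φ.comp ψ = RatMap.id

end RatMap

/-- The coordinates of a polynomial automorphism are algebraically independent. -/
theorem PolyAut.algebraicIndependent (f : PolyAut) : AlgebraicIndependent ℂ f.toMap := by
  have h : (MvPolynomial.bind₁ f.invMap).comp (MvPolynomial.aeval f.toMap) =
      AlgHom.id ℂ Poly := by
    apply MvPolynomial.algHom_ext
    intro i
    simpa [PolyMap.comp, PolyMap.id] using congrFun f.comp_inv i
  exact Function.LeftInverse.injective (g := MvPolynomial.bind₁ f.invMap)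
    fun P => DFunLike.congr_fun h P

/-- A polynomial automorphism, seen as a rational map. -/
noncomputable def PolyAut.toRatMap (f : PolyAut) : RatMap where
  coord i := algebraMap Poly RatFun (f.toMap i)
  dominant := f.algebraicIndependent.map'
    (f := IsScalarTower.toAlgHom ℂ Poly RatFun) (IsFractionRing.injective Poly RatFun)

end AffinePlane

/-!
A birational map `ψ` conjugating `f` to `g` has no poles, because its polar curves would form a
finite family of curves permuted by the Hénon automorphism `f`. Applied to `ψ` and to its inverse,
which conjugates `g` to `f`, this makes both of them polynomial.

*Polar curves are permuted.* Let `p` be irreducible and let `O_p` be the local ring of rational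
functions regular along `p = 0`. The coordinates of `ψ ∘ f = g ∘ ψ` are polynomials in those of `ψ`,
and conversely, as `g` is a polynomial automorphism. So the coordinates of `ψ` lie in `O_p` if and
only if those of `ψ ∘ f` do. Thus `p` is polar, meaning that some coordinate of `ψ` is not in `O_p`,
if and only if `p ∘ f⁻¹` is. Every polar `p` divides the product of the denominators
of `ψ`, so the degrees of the polar `p` are bounded (`exists_polyMap_of_comp_eq_comp`).

*A generalized Hénon map permutes no such family.* Let `E` and `E'` be elementary Hénon maps, of
degrees `d, d' ≥ 2`, and let `x ^ i y ^ j` be a monomial of top degree in a nonconstant polynomial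
`P`. Then `deg (P ∘ E) ≥ d i`, strictly if `j ≠ 0`
(`natDegree_mul_le_totalDegree_bind₁_henonMap`), and symmetrically `deg (P ∘ E'⁻¹) ≥ d' j`, strictly
if `i ≠ 0`, so that `deg (P ∘ E) + deg (P ∘ E'⁻¹) > 2 deg P`. This convexity shows that the degree
grows under every elementary Hénon map or under the inverse of every one
(`forwardGrowing_or_backwardGrowing`), and that growth, once begun, continues. Hence the degree is
unbounded along the forward or the backward orbit of `P`
(`IsGeneralizedHenon.eq_empty_of_invariant`).

The lower bound on `deg (P ∘ E)` is read off the Newton polygon. Let `W` be the degree of `P` for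
the weights `(d, 1)` of `(x, y)`, and `h(x)` its top form at `y = 1`. Since `x ^ i y ^ j` has top
degree, `x ^ i` divides `h`, while `d deg h ≤ W`. Substituting `y = z x ^ d` in `P ∘ E` gives
`h(a z + l)` as coefficient of `x ^ W`, where `l ≠ 0` is the leading coefficient of the polynomial
defining `E`. It has a nonzero coefficient at some `z ^ k` with `k ≤ deg h - i`, so `P ∘ E` contains
`x ^ (W - d k) y ^ k`, and `W - d k ≥ d i`.
-/

namespace AffinePlane

open MvPolynomial

/-! ### Growth of the degree under elementary Hénon maps -/

theorem Poly.aeval_eq_sum {A : Type*} [CommRing A] [Algebra ℂ A] (v : Fin 2 → A) (P : Poly) :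
    aeval v P = ∑ m ∈ P.support, algebraMap ℂ A (P.coeff m) * (v 0 ^ m 0 * v 1 ^ m 1) := by
  simp [aeval_def, eval₂_eq', Fin.prod_univ_two]

/-- If `P` has degree at most `W` for the weights `(d, 1)` and `u` has degree at most `d` in `X`,
the coefficient of `X ^ W` in `P(u, X)` is the form of weight `W` of `P`, evaluated at the
coefficient of `X ^ d` in `u` and at `1`. -/
theorem Poly.coeff_aeval_fst (u : Polynomial (Polynomial ℂ)) {d W : ℕ} (hu : u.natDegree ≤ d)
    (P : Poly) (hW : ∀ m ∈ P.support, d * m 0 + m 1 ≤ W) :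
    (aeval ![u, Polynomial.X] P).coeff W =
      (∑ m ∈ P.support with d * m 0 + m 1 = W,
        Polynomial.C (P.coeff m) * Polynomial.X ^ m 0 : Polynomial ℂ).comp (u.coeff d) := by
  rw [Poly.aeval_eq_sum, Polynomial.finsetSum_coeff, Polynomial.sum_comp, Finset.sum_filter]
  refine Finset.sum_congr rfl fun m hm => ?_
  have hdeg : (u ^ m 0).natDegree ≤ d * m 0 :=
    (Polynomial.natDegree_pow_le_of_le _ hu).trans_eq (mul_comm _ _)
  rw [show algebraMap ℂ (Polynomial (Polynomial ℂ)) (P.coeff m) =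
    Polynomial.C (Polynomial.C (P.coeff m)) from rfl, Polynomial.coeff_C_mul]
  simp only [Matrix.cons_val_zero, Matrix.cons_val_one, Polynomial.mul_comp, Polynomial.C_comp,
    Polynomial.pow_comp, Polynomial.X_comp]
  split_ifs with h
  · rw [← h, Polynomial.coeff_mul_X_pow, mul_comm d, Polynomial.coeff_pow_of_natDegree_le hu]
  · rw [Polynomial.coeff_mul_X_pow', if_pos (by have := hW m hm; omega),
      Polynomial.coeff_eq_zero_of_natDegree_lt (by have := hW m hm; omega), mul_zero]

/-- The coefficient of `x ^ W` in `Q(x, z x ^ d)`, seen in `ℂ[z][x]`, is the form of weight `W` of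
`Q`, for the weights `(1, d)`, evaluated at `(1, z)`. -/
theorem Poly.coeff_aeval_snd (d W : ℕ) (Q : Poly) :
    (aeval ![Polynomial.X, Polynomial.C Polynomial.X * Polynomial.X ^ d] Q :
      Polynomial (Polynomial ℂ)).coeff W =
      ∑ m ∈ Q.support with m 0 + d * m 1 = W,
        Polynomial.C (Q.coeff m) * Polynomial.X ^ m 1 := by
  rw [Poly.aeval_eq_sum, Polynomial.finsetSum_coeff, Finset.sum_filter]
  refine Finset.sum_congr rfl fun m _ => ?_
  rw [show algebraMap ℂ (Polynomial (Polynomial ℂ)) (Q.coeff m) =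
    Polynomial.C (Polynomial.C (Q.coeff m)) from rfl, Polynomial.coeff_C_mul]
  simp only [Matrix.cons_val_zero, Matrix.cons_val_one]
  rw [mul_pow, ← pow_mul, ← Polynomial.C_pow, mul_left_comm, ← pow_add, Polynomial.coeff_C_mul,
    Polynomial.coeff_X_pow]
  by_cases h : m 0 + d * m 1 = W
  · simp [h]
  · simp [h, Ne.symm h]

/-- If `h` vanishes to order `i` at `0`, it vanishes to order at most `deg h - i` at any other
point `l`. -/
theorem exists_coeff_comp_ne_zero {h : Polynomial ℂ} (h0 : h ≠ 0) {i : ℕ}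
    (hi : Polynomial.X ^ i ∣ h) {a l : ℂ} (ha : a ≠ 0) (hl : l ≠ 0) :
    ∃ k, k + i ≤ h.natDegree ∧
      (h.comp (Polynomial.C a * Polynomial.X + Polynomial.C l)).coeff k ≠ 0 := by
  obtain ⟨q, rfl⟩ := hi
  have hq : q ≠ 0 := right_ne_zero_of_mul h0
  set L : Polynomial ℂ := Polynomial.C a * Polynomial.X + Polynomial.C l with hL
  have hLdeg : L.natDegree = 1 := Polynomial.natDegree_linear ha
  have hLi0 : (L ^ i).coeff 0 ≠ 0 := by simp [Polynomial.coeff_zero_eq_eval_zero, hL, hl]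
  have hLi : L ^ i ≠ 0 := fun e => hLi0 (by simp [e])
  have hqL : q.comp L ≠ 0 := by
    rw [Ne, Polynomial.comp_eq_zero_iff]
    rintro (h | ⟨-, h⟩)
    · exact hq h
    · rw [h, Polynomial.natDegree_C] at hLdeg
      exact zero_ne_one hLdeg
  have key : ((Polynomial.X ^ i * q).comp L) = L ^ i * q.comp L := by simp
  have hne : ((Polynomial.X ^ i * q).comp L) ≠ 0 := key ▸ mul_ne_zero hLi hqL
  refine ⟨((Polynomial.X ^ i * q).comp L).natTrailingDegree, ?_, ?_⟩
  · rw [key, Polynomial.natTrailingDegree_mul hLi hqL,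
      Polynomial.natTrailingDegree_eq_zero.2 (Or.inr hLi0), zero_add,
      Polynomial.natDegree_X_pow_mul i hq]
    have := Polynomial.natTrailingDegree_le_natDegree (q.comp L)
    rw [Polynomial.natDegree_comp, hLdeg, mul_one] at this
    omega
  · exact Polynomial.trailingCoeff_nonzero_iff_nonzero.2 hne

theorem add_le_totalDegree {P : Poly} {m : Fin 2 →₀ ℕ} (hm : m ∈ P.support) :
    m 0 + m 1 ≤ P.totalDegree := by
  have := le_totalDegree hm
  rwa [Finsupp.sum_fintype _ _ (fun _ => rfl), Fin.sum_univ_two] at this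

/-- A monomial `x ^ i y ^ j` of top degree in `P` forces `deg (P ∘ E) ≥ d i`, with strict inequality
if `j ≠ 0`, for a Hénon map `E` of degree `d`. -/
theorem natDegree_mul_le_totalDegree_bind₁_henonMap {a : ℂ} {p : Polynomial ℂ} (ha : a ≠ 0)
    (hp : 2 ≤ p.natDegree) {P : Poly} {m : Fin 2 →₀ ℕ} (hm : m ∈ P.support)
    (hdeg : m 0 + m 1 = P.totalDegree) :
    p.natDegree * m 0 ≤ (bind₁ (henonMap a p) P).totalDegree ∧
      (m 1 ≠ 0 → p.natDegree * m 0 < (bind₁ (henonMap a p) P).totalDegree) := by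
  set d := p.natDegree with hd
  set Q := bind₁ (henonMap a p) P with hQ
  -- `W` is the degree of `P` for the weights `(d, 1)` of `(x, y)`.
  obtain ⟨w, hw, hwmax⟩ := P.support.exists_max_image (fun m => d * m 0 + m 1) ⟨m, hm⟩
  set W := d * w 0 + w 1 with hW
  -- `h` is the top form of `P` for these weights, evaluated at `y = 1`.
  set h : Polynomial ℂ := ∑ m ∈ P.support with d * m 0 + m 1 = W,
    Polynomial.C (P.coeff m) * Polynomial.X ^ m 0 with hh
  have hcoeff : ∀ r, h.coeff r = ∑ m ∈ P.support with d * m 0 + m 1 = W,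
      if r = m 0 then P.coeff m else 0 := by
    intro r
    simp [hh, Polynomial.coeff_X_pow]
  have h0 : h ≠ 0 := by
    intro e
    have := hcoeff (w 0)
    rw [Finset.sum_eq_single w] at this
    · rw [e, if_pos rfl, Polynomial.coeff_zero] at this
      exact mem_support_iff.1 hw this.symm
    · intro n hn hne
      rw [if_neg]
      intro e'
      apply hne
      have := (Finset.mem_filter.1 hn).2
      rw [hW, ← e'] at this
      ext s
      fin_cases s
      · exact e'.symm
      · exact Nat.add_left_cancel this
    · intro hn
      exact (hn (Finset.mem_filter.2 ⟨hw, rfl⟩)).elim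
  -- The monomials of weight `W` have `x`-degree at least `m 0`, as `m` has top degree.
  have hdvd : Polynomial.X ^ m 0 ∣ h := by
    rw [Polynomial.X_pow_dvd_iff]
    intro r hr
    rw [hcoeff]
    refine Finset.sum_eq_zero fun n hn => ?_
    rw [if_neg]
    rintro rfl
    obtain ⟨hn, hnW⟩ := Finset.mem_filter.1 hn
    have h1 := add_le_totalDegree hn
    have h2 := hwmax m hm
    obtain ⟨e, he⟩ := Nat.exists_eq_add_of_lt hr
    rw [← hnW, he] at h2
    rw [he] at hdeg
    nlinarith
  have hdegh : d * h.natDegree ≤ W := by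
    have h1 : h.coeff h.natDegree ≠ 0 := Polynomial.leadingCoeff_ne_zero.2 h0
    rw [hcoeff] at h1
    obtain ⟨n, hn, hne⟩ := Finset.exists_ne_zero_of_sum_ne_zero h1
    have hn0 : h.natDegree = n 0 := by
      by_contra hc
      exact hne (if_neg hc)
    rw [hn0, ← (Finset.mem_filter.1 hn).2]
    omega
  have hl : p.leadingCoeff ≠ 0 := by
    rw [Ne, Polynomial.leadingCoeff_eq_zero]
    rintro rfl
    simp at hd
    omega
  obtain ⟨k, hk, hkne⟩ := exists_coeff_comp_ne_zero h0 hdvd ha hl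
  -- Both sides of `P (E (x, z x ^ d)) = Q (x, z x ^ d)`, seen in `ℂ[z][x]`.
  set u : Polynomial (Polynomial ℂ) := Polynomial.C (Polynomial.C a * Polynomial.X) *
    Polynomial.X ^ d + p.map Polynomial.C with hu
  have hudeg : u.natDegree ≤ d :=
    (Polynomial.natDegree_add_le _ _).trans
      (max_le (Polynomial.natDegree_C_mul_X_pow_le _ _) Polynomial.natDegree_map_le)
  have hucoeff : u.coeff d = Polynomial.C a * Polynomial.X + Polynomial.C p.leadingCoeff := by
    rw [hu, Polynomial.coeff_add, Polynomial.coeff_C_mul_X_pow, if_pos rfl, Polynomial.coeff_map]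
    rfl
  have heval : aeval ![u, Polynomial.X] P =
      (aeval ![Polynomial.X, Polynomial.C Polynomial.X * Polynomial.X ^ d] Q :
        Polynomial (Polynomial ℂ)) := by
    rw [hQ, aeval_bind₁]
    congr 2
    funext s
    fin_cases s
    · simp only [henonMap, Fin.zero_eta, Matrix.cons_val_zero, map_add, map_mul, aeval_X,
        Matrix.cons_val_one, ← Polynomial.aeval_algHom_apply, hu]
      rw [show (p.map Polynomial.C) = Polynomial.aeval Polynomial.X p by
        rw [← Polynomial.aeval_map_algebraMap (Polynomial ℂ), Polynomial.aeval_X_left_apply]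
        rfl]
      rw [show aeval _ (C a : Poly) = Polynomial.C (Polynomial.C a) from aeval_C _ _]
      ring
    · simp [henonMap]
  have hcmp := Poly.coeff_aeval_fst u hudeg P hwmax
  rw [heval, Poly.coeff_aeval_snd, hucoeff, ← hh] at hcmp
  rw [← hcmp, Polynomial.finsetSum_coeff] at hkne
  obtain ⟨n, hn, hne⟩ := Finset.exists_ne_zero_of_sum_ne_zero hkne
  obtain ⟨hn, hnW⟩ := Finset.mem_filter.1 hn
  have hn1 : k = n 1 := by
    by_contra hc
    exact hne (by simp [Polynomial.coeff_X_pow, hc])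
  subst hn1
  have h1 := add_le_totalDegree hn
  have h2 := hwmax m hm
  have h3 : d * n 1 + d * m 0 ≤ W := by
    rw [← mul_add]
    exact (Nat.mul_le_mul_left d hk).trans hdegh
  refine ⟨by omega, fun hm1 => ?_⟩
  rcases Nat.eq_zero_or_pos (n 1) with hz | hz
  · rw [hz] at hnW
    simp only [mul_zero] at hnW
    omega
  · omega

/-- The inverse of `(x, y) ↦ (a y + p(x), x)` is, up to exchanging the coordinates on both sides,
again a Hénon map. -/
theorem bind₁_henonMap_rename_swap {a : ℂ} (ha : a ≠ 0) (p : Polynomial ℂ) (Q : Poly) :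
    bind₁ (henonMap a⁻¹ (-(Polynomial.C a⁻¹ * p)))
      (rename (Equiv.swap 0 1) (bind₁ (henonMap a p) Q)) = rename (Equiv.swap 0 1) Q := by
  suffices h : ((bind₁ (henonMap a⁻¹ (-(Polynomial.C a⁻¹ * p)))).comp
      ((rename (Equiv.swap (0 : Fin 2) 1)).comp (bind₁ (henonMap a p)))) =
      rename (Equiv.swap 0 1) from DFunLike.congr_fun h Q
  apply algHom_ext
  intro i
  have hC : (C a : Poly) * C a⁻¹ = 1 := by rw [← C_mul, mul_inv_cancel₀ ha, C_1]
  fin_cases i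
  · simp only [AlgHom.comp_apply, henonMap, Fin.zero_eta, bind₁_X_right, Matrix.cons_val_zero,
      map_add, map_mul, rename_C, rename_X, Equiv.swap_apply_right, Equiv.swap_apply_left,
      ← Polynomial.aeval_algHom_apply, Matrix.cons_val_one, bind₁_C_right, map_neg,
      Polynomial.aeval_C]
    rw [show algebraMap ℂ Poly a⁻¹ = C a⁻¹ from rfl]
    linear_combination (X 1 - Polynomial.aeval (X 0 : Poly) p) * hC
  · simp [henonMap]

/-- A monomial `x ^ i y ^ j` of top degree in `P` forces `deg (P ∘ E⁻¹) ≥ d j`, with strict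
inequality if `i ≠ 0`, for a Hénon map `E` of degree `d`. -/
theorem natDegree_mul_le_totalDegree_of_bind₁_henonMap_eq {a : ℂ} {p : Polynomial ℂ} (ha : a ≠ 0)
    (hp : 2 ≤ p.natDegree) {P Q : Poly} (hQ : bind₁ (henonMap a p) Q = P) {m : Fin 2 →₀ ℕ}
    (hm : m ∈ P.support) (hdeg : m 0 + m 1 = P.totalDegree) :
    p.natDegree * m 1 ≤ Q.totalDegree ∧ (m 0 ≠ 0 → p.natDegree * m 1 < Q.totalDegree) := by
  have hswap : ∀ R : Poly,
      (rename (Equiv.swap (0 : Fin 2) 1) R).totalDegree = R.totalDegree :=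
    totalDegree_renameEquiv (Equiv.swap (0 : Fin 2) 1)
  have hp' : (-(Polynomial.C a⁻¹ * p)).natDegree = p.natDegree := by
    rw [Polynomial.natDegree_neg, Polynomial.natDegree_C_mul (inv_ne_zero ha)]
  have hinj := (Equiv.swap (0 : Fin 2) 1).injective
  set m' : Fin 2 →₀ ℕ := Finsupp.mapDomain (Equiv.swap (0 : Fin 2) 1) m with hm'
  have h0 : m' 0 = m 1 := by
    have := Finsupp.mapDomain_apply hinj m 1
    rwa [Equiv.swap_apply_right] at this
  have h1 : m' 1 = m 0 := by
    have := Finsupp.mapDomain_apply hinj m 0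
    rwa [Equiv.swap_apply_left] at this
  have hmem : m' ∈ (rename (Equiv.swap (0 : Fin 2) 1) P).support := by
    rw [mem_support_iff, hm', coeff_rename_mapDomain _ hinj]
    exact mem_support_iff.1 hm
  have key := natDegree_mul_le_totalDegree_bind₁_henonMap (inv_ne_zero ha)
    (p := -(Polynomial.C a⁻¹ * p)) (by rwa [hp']) hmem (by rw [hswap, h0, h1, ← hdeg, add_comm])
  rwa [← hQ, bind₁_henonMap_rename_swap ha, hswap, hp', h0, h1] at key

/-- Composing `P` with any elementary Hénon map of degree at least `2` raises the degree. -/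
def ForwardGrowing (P : Poly) : Prop :=
  ∀ (a : ℂ) (p : Polynomial ℂ), a ≠ 0 → 2 ≤ p.natDegree →
    P.totalDegree < (bind₁ (henonMap a p) P).totalDegree

/-- Composing `P` with the inverse of any elementary Hénon map of degree at least `2` raises the
degree. The composite `Q = P ∘ E⁻¹` is described by `Q ∘ E = P`. -/
def BackwardGrowing (P : Poly) : Prop :=
  ∀ (a : ℂ) (p : Polynomial ℂ), a ≠ 0 → 2 ≤ p.natDegree →
    ∀ Q : Poly, bind₁ (henonMap a p) Q = P → P.totalDegree < Q.totalDegree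

/-- The sum of the degrees of `P ∘ E` and `P ∘ E'⁻¹` exceeds twice the degree of `P`, so that one of
the two degrees has to grow. -/
theorem forwardGrowing_or_backwardGrowing {P : Poly} (hP : P.totalDegree ≠ 0) :
    ForwardGrowing P ∨ BackwardGrowing P := by
  by_contra! h
  obtain ⟨hf, hb⟩ := h
  simp only [ForwardGrowing, not_forall, not_lt] at hf
  simp only [BackwardGrowing, not_forall, not_lt] at hb
  obtain ⟨a, p, ha, hp, hle⟩ := hf
  obtain ⟨b, q, hb, hq, Q, hQ, hle'⟩ := hb
  have hne : P.support.Nonempty := by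
    rw [Finset.nonempty_iff_ne_empty, Ne, support_eq_empty]
    rintro rfl
    exact hP totalDegree_zero
  obtain ⟨m, hm, hmdeg⟩ := Finset.exists_mem_eq_sup _ hne fun m : Fin 2 →₀ ℕ => m.sum fun _ e => e
  have hdeg : m 0 + m 1 = P.totalDegree := by
    rw [totalDegree, hmdeg, Finsupp.sum_fintype _ _ (fun _ => rfl), Fin.sum_univ_two]
  obtain ⟨h1, h2⟩ := natDegree_mul_le_totalDegree_bind₁_henonMap ha hp hm hdeg
  obtain ⟨h3, h4⟩ := natDegree_mul_le_totalDegree_of_bind₁_henonMap_eq hb hq hQ hm hdeg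
  have h5 := Nat.mul_le_mul_right (m 0) hp
  have h6 := Nat.mul_le_mul_right (m 1) hq
  by_cases hm1 : m 1 = 0
  · have := h4 (by omega)
    omega
  · have := h2 hm1
    omega

theorem bind₁_polyMap_comp (f g : PolyMap) (P : Poly) :
    bind₁ (f.comp g) P = bind₁ g (bind₁ f P) :=
  (bind₁_bind₁ f g P).symm

/-- Forward growth persists: if `E` raises the degree of `P`, then `E⁻¹` lowers that of `P ∘ E`,
which is therefore not backward growing. -/
theorem IsGeneralizedHenon.forwardGrowing {F : PolyMap} (hF : IsGeneralizedHenon F) :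
    ∀ {P : Poly}, ForwardGrowing P →
      ForwardGrowing (bind₁ F P) ∧ P.totalDegree < (bind₁ F P).totalDegree := by
  induction hF with
  | single a p ha hp =>
    intro P hP
    have hlt := hP a p ha hp
    refine ⟨(forwardGrowing_or_backwardGrowing (by omega)).resolve_right fun hb => ?_, hlt⟩
    exact (hb a p ha hp P rfl).not_gt hlt
  | comp f g _ _ ihf ihg =>
    intro P hP
    obtain ⟨h1, h2⟩ := ihf hP
    obtain ⟨h3, h4⟩ := ihg h1
    rw [bind₁_polyMap_comp]
    exact ⟨h3, h2.trans h4⟩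

/-- Backward growth persists along `Q = P ∘ F⁻¹`. -/
theorem IsGeneralizedHenon.backwardGrowing {F : PolyMap} (hF : IsGeneralizedHenon F) :
    ∀ {P Q : Poly}, bind₁ F Q = P → BackwardGrowing P →
      BackwardGrowing Q ∧ P.totalDegree < Q.totalDegree := by
  induction hF with
  | single a p ha hp =>
    intro P Q hQ hP
    have hlt := hP a p ha hp Q hQ
    refine ⟨(forwardGrowing_or_backwardGrowing (by omega)).resolve_left fun hf => ?_, hlt⟩
    exact (hf a p ha hp).not_gt (hQ ▸ hlt)
  | comp f g _ _ ihf ihg =>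
    intro P Q hQ hP
    rw [bind₁_polyMap_comp] at hQ
    obtain ⟨h1, h2⟩ := ihg hQ hP
    obtain ⟨h3, h4⟩ := ihf rfl h1
    exact ⟨h3, h2.trans h4⟩

/-- A generalized Hénon map has no invariant curve, nor any invariant family of curves of bounded
degree: the degree grows without bound along the forward or along the backward orbit of every
nonconstant polynomial. -/
theorem IsGeneralizedHenon.eq_empty_of_invariant {F : PolyMap} (hF : IsGeneralizedHenon F)
    {S : Set Poly} {B : ℕ} (hpos : ∀ P ∈ S, P.totalDegree ≠ 0) (hB : ∀ P ∈ S, P.totalDegree ≤ B)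
    (hfwd : ∀ P ∈ S, bind₁ F P ∈ S) (hbwd : ∀ P ∈ S, ∃ Q ∈ S, bind₁ F Q = P) : S = ∅ := by
  rw [Set.eq_empty_iff_forall_notMem]
  intro P hP
  rcases forwardGrowing_or_backwardGrowing (hpos P hP) with h | h
  · have : ∀ n : ℕ, ∃ Q ∈ S, ForwardGrowing Q ∧ n ≤ Q.totalDegree := by
      intro n
      induction n with
      | zero => exact ⟨P, hP, h, Nat.zero_le _⟩
      | succ n ih =>
        obtain ⟨Q, hQ, hg, hn⟩ := ih
        obtain ⟨hg', hlt⟩ := hF.forwardGrowing hg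
        exact ⟨_, hfwd Q hQ, hg', by omega⟩
    obtain ⟨Q, hQ, -, hn⟩ := this (B + 1)
    have := hB Q hQ
    omega
  · have : ∀ n : ℕ, ∃ Q ∈ S, BackwardGrowing Q ∧ n ≤ Q.totalDegree := by
      intro n
      induction n with
      | zero => exact ⟨P, hP, h, Nat.zero_le _⟩
      | succ n ih =>
        obtain ⟨Q, hQ, hg, hn⟩ := ih
        obtain ⟨R, hR, hRQ⟩ := hbwd Q hQ
        obtain ⟨hg', hlt⟩ := hF.backwardGrowing hRQ hg
        exact ⟨R, hR, hg', by omega⟩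
    obtain ⟨Q, hQ, -, hn⟩ := this (B + 1)
    have := hB Q hQ
    omega

/-! ### Composition of rational maps -/

namespace RatMap

theorem pullback_X (ψ : RatMap) (i : Fin 2) :
    ψ.pullback (algebraMap Poly RatFun (X i)) = ψ.coord i := by
  rw [pullback_algebraMap, aeval_X]

theorem pullback_id (u : RatFun) : RatMap.id.pullback u = u := by
  suffices h : RatMap.id.pullback = AlgHom.id ℂ RatFun from DFunLike.congr_fun h u
  apply IsLocalization.algHom_ext (nonZeroDivisors Poly)
  apply algHom_ext
  intro i
  exact pullback_X _ i

theorem pullback_comp (ψ φ : RatMap) (u : RatFun) :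
    (ψ.comp φ).pullback u = φ.pullback (ψ.pullback u) := by
  suffices h : (ψ.comp φ).pullback = φ.pullback.comp ψ.pullback from DFunLike.congr_fun h u
  apply IsLocalization.algHom_ext (nonZeroDivisors Poly)
  apply algHom_ext
  intro i
  exact (pullback_X _ i).trans (congrArg φ.pullback (pullback_X ψ i)).symm

theorem comp_assoc (ψ φ χ : RatMap) : (ψ.comp φ).comp χ = ψ.comp (φ.comp χ) :=
  RatMap.ext (funext fun i => (pullback_comp φ χ (ψ.coord i)).symm)

theorem id_comp (ψ : RatMap) : RatMap.id.comp ψ = ψ :=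
  RatMap.ext (funext fun i => pullback_X ψ i)

theorem comp_id (ψ : RatMap) : ψ.comp RatMap.id = ψ :=
  RatMap.ext (funext fun i => pullback_id (ψ.coord i))

/-- If `ψ` conjugates `f` to `g`, then its inverse conjugates `g` to `f`. -/
theorem comp_eq_comp_of_inverse {ψ φ f g : RatMap} (h₁ : ψ.comp φ = RatMap.id)
    (h₂ : φ.comp ψ = RatMap.id) (h : ψ.comp f = g.comp ψ) : φ.comp g = f.comp φ :=
  calc φ.comp g = φ.comp ((g.comp ψ).comp φ) := by rw [comp_assoc, h₁, comp_id]
    _ = f.comp φ := by rw [← h, comp_assoc, ← comp_assoc, h₂, id_comp]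

end RatMap

namespace PolyAut

theorem bind₁_toMap_bind₁_invMap (f : PolyAut) (P : Poly) :
    bind₁ f.toMap (bind₁ f.invMap P) = P := by
  rw [← bind₁_polyMap_comp, f.inv_comp]
  exact DFunLike.congr_fun (aeval_unique (AlgHom.id ℂ Poly)).symm P

theorem bind₁_invMap_bind₁_toMap (f : PolyAut) (P : Poly) :
    bind₁ f.invMap (bind₁ f.toMap P) = P := by
  rw [← bind₁_polyMap_comp, f.comp_inv]
  exact DFunLike.congr_fun (aeval_unique (AlgHom.id ℂ Poly)).symm P

/-- The automorphism `P ↦ P ∘ f` of the ring of polynomials. -/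
noncomputable def algEquiv (f : PolyAut) : Poly ≃ₐ[ℂ] Poly :=
  AlgEquiv.ofAlgHom (bind₁ f.toMap) (bind₁ f.invMap)
    (AlgHom.ext f.bind₁_toMap_bind₁_invMap) (AlgHom.ext f.bind₁_invMap_bind₁_toMap)

theorem algEquiv_apply (f : PolyAut) (P : Poly) : f.algEquiv P = bind₁ f.toMap P := rfl

theorem pullback_toRatMap_algebraMap (f : PolyAut) (P : Poly) :
    f.toRatMap.pullback (algebraMap Poly RatFun P) = algebraMap Poly RatFun (f.algEquiv P) := by
  rw [RatMap.pullback_algebraMap, algEquiv_apply]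
  exact aeval_algebraMap_apply _ f.toMap P

end PolyAut

/-! ### Polar curves -/

/-- The rational function `u` has no pole along the curve `p = 0`: it is a fraction whose
denominator is not divisible by `p`. -/
def IsRegularAlong (p : Poly) (u : RatFun) : Prop :=
  ∃ a b : Poly, ¬ p ∣ b ∧ u * algebraMap Poly RatFun b = algebraMap Poly RatFun a

theorem IsRegularAlong.add {p : Poly} (hp : Prime p) {u v : RatFun} (hu : IsRegularAlong p u)
    (hv : IsRegularAlong p v) : IsRegularAlong p (u + v) := by
  obtain ⟨a, b, hb, h⟩ := hu
  obtain ⟨a', b', hb', h'⟩ := hv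
  refine ⟨a * b' + a' * b, b * b', hp.not_dvd_mul hb hb', ?_⟩
  rw [map_mul, map_add, map_mul, map_mul, ← h, ← h']
  ring

theorem IsRegularAlong.mul {p : Poly} (hp : Prime p) {u v : RatFun} (hu : IsRegularAlong p u)
    (hv : IsRegularAlong p v) : IsRegularAlong p (u * v) := by
  obtain ⟨a, b, hb, h⟩ := hu
  obtain ⟨a', b', hb', h'⟩ := hv
  refine ⟨a * a', b * b', hp.not_dvd_mul hb hb', ?_⟩
  rw [map_mul, map_mul, ← h, ← h']
  ring

theorem IsRegularAlong.aeval {p : Poly} (hp : Prime p) {v : Fin 2 → RatFun}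
    (hv : ∀ i, IsRegularAlong p (v i)) (Q : Poly) : IsRegularAlong p (aeval v Q) := by
  induction Q using MvPolynomial.induction_on with
  | C c =>
    refine ⟨C c, 1, hp.not_dvd_one, ?_⟩
    rw [map_one, mul_one, aeval_C]
    rfl
  | add P Q hP hQ => rw [map_add]; exact hP.add hp hQ
  | mul_X P i hP => rw [map_mul, aeval_X]; exact hP.mul hp (hv i)

/-- The poles of `u ∘ f` are the preimages of those of `u`: the automorphism `f` maps the curve
`p ∘ f = 0` to the curve `p = 0`. -/
theorem PolyAut.isRegularAlong_pullback (f : PolyAut) {p : Poly} {u : RatFun} :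
    IsRegularAlong (f.algEquiv p) (f.toRatMap.pullback u) ↔ IsRegularAlong p u := by
  constructor
  · rintro ⟨a, b, hb, h⟩
    refine ⟨f.algEquiv.symm a, f.algEquiv.symm b, fun hd => hb ?_, ?_⟩
    · simpa using map_dvd f.algEquiv hd
    · apply f.toRatMap.pullback.toRingHom.injective
      change f.toRatMap.pullback _ = f.toRatMap.pullback _
      rw [map_mul, f.pullback_toRatMap_algebraMap, f.pullback_toRatMap_algebraMap,
        AlgEquiv.apply_symm_apply, AlgEquiv.apply_symm_apply, h]
  · rintro ⟨a, b, hb, h⟩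
    refine ⟨f.algEquiv a, f.algEquiv b, fun hd => hb ?_, ?_⟩
    · simpa using map_dvd f.algEquiv.symm hd
    · rw [← f.pullback_toRatMap_algebraMap, ← f.pullback_toRatMap_algebraMap, ← map_mul, h]

/-- A rational function without poles is a polynomial. -/
theorem exists_algebraMap_eq_of_isRegularAlong {u : RatFun}
    (h : ∀ p, Prime p → IsRegularAlong p u) : ∃ P : Poly, algebraMap Poly RatFun P = u := by
  have hu : IsUnit (IsFractionRing.den Poly u : Poly) := by
    by_contra hu
    obtain ⟨p, hp, hpd⟩ := WfDvdMonoid.exists_irreducible_factor hu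
      (nonZeroDivisors.ne_zero (IsFractionRing.den Poly u).2)
    obtain ⟨a, b, hb, hab⟩ := h p hp.prime
    have hnd : algebraMap Poly RatFun (IsFractionRing.num Poly u) =
        u * algebraMap Poly RatFun (IsFractionRing.den Poly u) := by
      rw [← IsLocalization.mk'_eq_iff_eq_mul.1 (IsFractionRing.mk'_num_den Poly u)]
    have hmul : a * IsFractionRing.den Poly u = IsFractionRing.num Poly u * b := by
      apply IsFractionRing.injective Poly RatFun
      rw [map_mul, map_mul, hnd, ← hab]
      ring
    have hpn : p ∣ IsFractionRing.num Poly u :=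
      (hp.prime.dvd_or_dvd (hmul ▸ hpd.mul_left a)).resolve_right hb
    exact hp.not_isUnit (IsFractionRing.num_den_reduced Poly u hpn hpd)
  exact IsFractionRing.isInteger_of_isUnit_den hu

theorem totalDegree_ne_zero_of_prime {p : Poly} (hp : Prime p) : p.totalDegree ≠ 0 := by
  intro h
  rw [totalDegree_eq_zero_iff_eq_C] at h
  have hc : coeff 0 p ≠ 0 := by
    intro hc
    rw [hc, C_0] at h
    exact hp.ne_zero h
  exact hp.not_isUnit (h ▸ (isUnit_iff_ne_zero.2 hc).map C)

/-- The polar curves of `ψ` are permuted by the Hénon automorphism `f`, so there are none. -/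
theorem exists_polyMap_of_comp_eq_comp {f g : PolyAut} (hf : f.IsHenon) {ψ : RatMap}
    (hconj : ψ.comp f.toRatMap = g.toRatMap.comp ψ) :
    ∃ P : PolyMap, ∀ i, algebraMap Poly RatFun (P i) = ψ.coord i := by
  obtain ⟨h, hF⟩ := hf
  have hcoord : ∀ i, f.toRatMap.pullback (ψ.coord i) = aeval ψ.coord (g.toMap i) := fun i =>
    (congrFun (congrArg RatMap.coord hconj) i).trans (ψ.pullback_algebraMap _)
  -- `ψ = g⁻¹ ∘ (ψ ∘ f)`, in coordinates.
  have hinv : ∀ i, ψ.coord i =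
      aeval (fun j => f.toRatMap.pullback (ψ.coord j)) (g.invMap i) := by
    intro i
    have := congrArg (aeval ψ.coord) (congrFun g.inv_comp i)
    simp only [PolyMap.comp, PolyMap.id, aeval_bind₁, aeval_X] at this
    simp only [hcoord]
    exact this.symm
  -- `S` is the set of irreducible equations of polar curves of `ψ`.
  set S : Set Poly := {p | Prime p ∧ ∃ i, ¬ IsRegularAlong p (ψ.coord i)} with hS
  have hprime : ∀ (k : PolyAut) {p : Poly}, Prime (k.algEquiv p) ↔ Prime p := fun k p =>
    MulEquiv.prime_iff k.algEquiv
  have hfS : ∀ p, f.algEquiv p ∈ S ↔ p ∈ S := by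
    intro p
    refine (and_congr_right_iff.2 ?_).trans (and_congr_left' (hprime f))
    intro hp
    rw [← not_forall, ← not_forall, not_iff_not]
    constructor
    · intro H i
      rw [← f.isRegularAlong_pullback, hcoord]
      exact IsRegularAlong.aeval hp H _
    · intro H i
      rw [hinv]
      exact IsRegularAlong.aeval hp (fun j => f.isRegularAlong_pullback.2 (H j)) _
  obtain ⟨D, hD0, hD⟩ : ∃ D : Poly, D ≠ 0 ∧ ∀ p ∈ S, p ∣ D := by
    have hden : ∀ i, ∃ a b : Poly, b ≠ 0 ∧
        ψ.coord i * algebraMap Poly RatFun b = algebraMap Poly RatFun a := by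
      intro i
      obtain ⟨⟨a, b⟩, hab⟩ := IsLocalization.surj (nonZeroDivisors Poly) (ψ.coord i)
      exact ⟨a, b, nonZeroDivisors.ne_zero b.2, hab⟩
    choose a b hb hab using hden
    refine ⟨∏ i, b i, Finset.prod_ne_zero_iff.2 fun i _ => hb i, ?_⟩
    rintro p ⟨-, i, hi⟩
    by_contra hd
    exact hi ⟨a i, b i, fun hpb => hd (hpb.trans (Finset.dvd_prod_of_mem b (Finset.mem_univ i))),
      hab i⟩
  -- The same set in the coordinates in which `f` is a generalized Hénon map.
  have hFapply : ∀ P, h.algEquiv (bind₁ ((h.toMap.comp f.toMap).comp h.invMap) P) =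
      f.algEquiv (h.algEquiv P) := by
    intro P
    rw [bind₁_polyMap_comp, bind₁_polyMap_comp]
    exact h.bind₁_toMap_bind₁_invMap _
  have hempty : (h.algEquiv ⁻¹' S : Set Poly) = ∅ := by
    refine hF.eq_empty_of_invariant (B := (h.algEquiv.symm D).totalDegree) ?_ ?_ ?_ ?_
    · intro P hP
      exact totalDegree_ne_zero_of_prime ((hprime h).1 hP.1)
    · intro P hP
      refine totalDegree_le_of_dvd_of_isDomain ?_
        ((map_ne_zero_iff _ h.algEquiv.symm.injective).2 hD0)
      simpa using map_dvd h.algEquiv.symm (hD _ hP)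
    · intro P hP
      rw [Set.mem_preimage, hFapply, hfS]
      exact hP
    · intro P hP
      refine ⟨h.algEquiv.symm (f.algEquiv.symm (h.algEquiv P)), ?_, ?_⟩
      · rw [Set.mem_preimage, AlgEquiv.apply_symm_apply, ← hfS, AlgEquiv.apply_symm_apply]
        exact hP
      · apply h.algEquiv.injective
        rw [hFapply, AlgEquiv.apply_symm_apply, AlgEquiv.apply_symm_apply]
  have hreg : ∀ i p, Prime p → IsRegularAlong p (ψ.coord i) := by
    intro i p hp
    by_contra hi
    have : h.algEquiv.symm p ∈ (h.algEquiv ⁻¹' S : Set Poly) := by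
      rw [Set.mem_preimage, AlgEquiv.apply_symm_apply]
      exact ⟨hp, i, hi⟩
    rw [hempty] at this
    exact this
  choose P hP using fun i => exists_algebraMap_eq_of_isRegularAlong (hreg i)
  exact ⟨P, hP⟩

/-! ### Composition of rational maps with polynomial coordinates -/

theorem RatMap.comp_coord_of_algebraMap {ψ φ : RatMap} {P Q : PolyMap}
    (hP : ∀ i, algebraMap Poly RatFun (P i) = ψ.coord i)
    (hQ : ∀ i, algebraMap Poly RatFun (Q i) = φ.coord i) (i : Fin 2) :
    (ψ.comp φ).coord i = algebraMap Poly RatFun (P.comp Q i) := by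
  have h : φ.coord = fun i => algebraMap Poly RatFun (Q i) := (funext hQ).symm
  change φ.pullback (ψ.coord i) = _
  rw [← hP, pullback_algebraMap, h]
  exact aeval_algebraMap_apply _ _ _

theorem polyMap_comp_eq_id {ψ φ : RatMap} (h : ψ.comp φ = RatMap.id) {P Q : PolyMap}
    (hP : ∀ i, algebraMap Poly RatFun (P i) = ψ.coord i)
    (hQ : ∀ i, algebraMap Poly RatFun (Q i) = φ.coord i) : P.comp Q = PolyMap.id := by
  funext i
  apply IsFractionRing.injective Poly RatFun
  rw [← RatMap.comp_coord_of_algebraMap hP hQ, h]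
  rfl

end AffinePlane

theorem mainTheorem3 (f g : AffinePlane.PolyAut) (hf : f.IsHenon) (hg : g.IsHenon)
    (ψ : AffinePlane.RatMap) (hψ : ψ.IsBirational)
    (hconj : ψ.comp f.toRatMap = g.toRatMap.comp ψ) :
    ∃ h : AffinePlane.PolyAut, h.toRatMap = ψ := by
  obtain ⟨φ, h₁, h₂⟩ := hψ
  obtain ⟨P, hP⟩ := AffinePlane.exists_polyMap_of_comp_eq_comp hf hconj
  obtain ⟨Q, hQ⟩ := AffinePlane.exists_polyMap_of_comp_eq_comp hg
    (AffinePlane.RatMap.comp_eq_comp_of_inverse h₁ h₂ hconj)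
  exact ⟨⟨P, Q, AffinePlane.polyMap_comp_eq_id h₁ hP hQ, AffinePlane.polyMap_comp_eq_id h₂ hQ hP⟩,
    AffinePlane.RatMap.ext (funext hP)⟩
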